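/- Let $\mathcal H_a=\mathbb C^{d_a}$ with $d_a\ge 2$ and $\mathcal H_b=\mathbb C^{d_b}$, let $\rho$ be a density matrix on $\mathcal H_a\otimes\mathcal H_b$ with marginal $\rho^a=\mathrm{tr}_b\,\rho$, and let $\|O\|=\sqrt{\mathrm{tr}(O^\dagger O)}$. Fix a measurement strength $x\in\mathbb R$ (in particular, any $x>0$) and put $\tau_1=\sqrt{(1-\tanh x)/2}$, $\tau_2=\sqrt{(1+\tanh x)/2}$. A weak measurement $\Omega$ of strength $x$ on $a$ is given by two nonzero orthogonal projectors $\Pi^1,\Pi^2$ on $\mathcal H_a$ with $\Pi^1+\Pi^2=\mathbb 1$, through the operators $$\Omega_x=\tau_1\Pi^1+\tau_2\Pi^2,\qquad \Omega_{-x}=\tau_2\Pi^1+\tau_1\Pi^2 .$$ It acts on operators $X$ of $ab$ by $\Omega(X)=\sum_{k=\pm x}(\Omega_k\otimes\mathbb 1)X(\Omega_k\otimes\mathbb 1)$ and on operators $Y$ of $a$ by $\Omega(Y)=\sum_{k=\pm x}\Omega_kY\Omega_k$. Put $$C_H(\rho|\Omega)=\|\sqrt\rho-\Omega(\sqrt\rho)\|^2,\qquad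 C_H(\rho^a|\Omega)=\|\sqrt{\rho^a}-\Omega(\sqrt{\rho^a})\|^2 ,$$ $$\mathcal Q_w(\rho)=\min_{\Omega}\big[C_H(\rho|\Omega)-C_H(\rho^a|\Omega)\big],$$ where $\Omega$ ranges over all weak measurements of strength $x$ on $a$. Then the minimum is attained, and $\mathcal Q_w(\rho)\ge 0$. Moreover $\mathcal Q_w(\rho)=0$ whenever $\rho$ is classically correlated, that is, whenever $\rho=\Pi^a(\rho):=\sum_k(|k\rangle\langle k|\otimes\mathbb 1)\,\rho\,(|k\rangle\langle k|\otimes\mathbb 1)$ for some orthonormal basis $\{|k\rangle\}$ of $\mathcal H_a$; and, more generally, whenever $\rho=\sum_{k=1,2}(\Pi^k\otimes\mathbb 1)\,\rho\,(\Pi^k\otimes\mathbb 1)$ for some pair of nonzero orthogonal projectors $\Pi^1,\Pi^2$ on $\mathcal H_a$ with $\Pi^1+\Pi^2=\mathbb 1$. -/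

import Mathlib

open scoped Matrix Kronecker MatrixOrder ComplexOrder

noncomputable section

/-- A quantum state on the Hilbert space `ℂ^ι`. -/
def IsDensityMatrix {ι : Type*} [Fintype ι] (ρ : Matrix ι ι ℂ) : Prop :=
  ρ.PosSemidef ∧ ρ.trace = 1

/-- The marginal state `ρ^a = tr_b ρ` of a bipartite state. -/
def marginalA {m n : Type*} [Fintype n] (ρ : Matrix (m × n) (m × n) ℂ) : Matrix m m ℂ :=
  Matrix.of fun i j => ∑ k, ρ (i, k) (j, k)

/-- The Hilbert-Schmidt norm `√(tr (O† O))`. -/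
def hsNorm {ι : Type*} [Fintype ι] (O : Matrix ι ι ℂ) : ℝ :=
  Real.sqrt ((Oᴴ * O).trace.re)

/-- A pair of nonzero orthogonal projectors `Π¹`, `Π²` with `Π¹ + Π² = 1`. -/
@[ext]
structure ProjectorPair (m : Type*) [Fintype m] [DecidableEq m] where
  P₁ : Matrix m m ℂ
  P₂ : Matrix m m ℂ
  isStarProjection₁ : IsStarProjection P₁
  isStarProjection₂ : IsStarProjection P₂
  orthogonal : P₁ * P₂ = 0
  sum_eq_one : P₁ + P₂ = 1
  ne_zero₁ : P₁ ≠ 0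
  ne_zero₂ : P₂ ≠ 0

/-- `τ₁ = √((1 - tanh x) / 2)`. -/
def tauOne (x : ℝ) : ℝ := Real.sqrt ((1 - Real.tanh x) / 2)

/-- `τ₂ = √((1 + tanh x) / 2)`. -/
def tauTwo (x : ℝ) : ℝ := Real.sqrt ((1 + Real.tanh x) / 2)

namespace ProjectorPair

variable {m : Type*} [Fintype m] [DecidableEq m]

/-- The weak measurement operator `Ω_x = τ₁ Π¹ + τ₂ Π²`. -/
def weakPos (P : ProjectorPair m) (x : ℝ) : Matrix m m ℂ :=
  (tauOne x : ℂ) • P.P₁ + (tauTwo x : ℂ) • P.P₂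

/-- The weak measurement operator `Ω_{-x} = τ₂ Π¹ + τ₁ Π²`. -/
def weakNeg (P : ProjectorPair m) (x : ℝ) : Matrix m m ℂ :=
  (tauTwo x : ℂ) • P.P₁ + (tauOne x : ℂ) • P.P₂

/-- The weak measurement map on operators of the system `a` alone. -/
def weakMap (P : ProjectorPair m) (x : ℝ) (X : Matrix m m ℂ) : Matrix m m ℂ :=
  P.weakPos x * X * P.weakPos x + P.weakNeg x * X * P.weakNeg x

/-- The weak measurement map on operators of the system `ab`, measuring the subsystem `a`. -/
def weakMapAB {n : Type*} [Fintype n] [DecidableEq n] (P : ProjectorPair m) (x : ℝ)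
    (X : Matrix (m × n) (m × n) ℂ) : Matrix (m × n) (m × n) ℂ :=
  (P.weakPos x ⊗ₖ (1 : Matrix n n ℂ)) * X * (P.weakPos x ⊗ₖ (1 : Matrix n n ℂ)) +
    (P.weakNeg x ⊗ₖ (1 : Matrix n n ℂ)) * X * (P.weakNeg x ⊗ₖ (1 : Matrix n n ℂ))

/-- The projective measurement `X ↦ ∑ₖ (Πᵏ ⊗ 1) X (Πᵏ ⊗ 1)` for the two projectors. -/
def projMapAB {n : Type*} [Fintype n] [DecidableEq n] (P : ProjectorPair m)
    (X : Matrix (m × n) (m × n) ℂ) : Matrix (m × n) (m × n) ℂ :=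
  (P.P₁ ⊗ₖ (1 : Matrix n n ℂ)) * X * (P.P₁ ⊗ₖ (1 : Matrix n n ℂ)) +
    (P.P₂ ⊗ₖ (1 : Matrix n n ℂ)) * X * (P.P₂ ⊗ₖ (1 : Matrix n n ℂ))

/-- `C_H(σ|Ω) = ‖√σ - Ω(√σ)‖²` for a state `σ` of the system `a`. -/
def coherence (P : ProjectorPair m) (x : ℝ) (σ : Matrix m m ℂ) : ℝ :=
  hsNorm (CFC.sqrt σ - P.weakMap x (CFC.sqrt σ)) ^ 2

/-- `C_H(ρ|Ω) = ‖√ρ - Ω(√ρ)‖²` for a state `ρ` of the system `ab`. -/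
def coherenceAB {n : Type*} [Fintype n] [DecidableEq n] (P : ProjectorPair m) (x : ℝ)
    (ρ : Matrix (m × n) (m × n) ℂ) : ℝ :=
  hsNorm (CFC.sqrt ρ - P.weakMapAB x (CFC.sqrt ρ)) ^ 2

/-- `Δ_w(ρ|Ω) = C_H(ρ|Ω) - C_H(ρ^a|Ω)`. -/
def deltaW {n : Type*} [Fintype n] [DecidableEq n] (P : ProjectorPair m) (x : ℝ)
    (ρ : Matrix (m × n) (m × n) ℂ) : ℝ :=
  P.coherenceAB x ρ - P.coherence x (marginalA ρ)

end ProjectorPair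

/-- `Q_w(ρ) = min_Ω Δ_w(ρ|Ω)`, over all weak measurements of the fixed strength `x` on `a`. -/
def weakCorrelation {m n : Type*} [Fintype m] [DecidableEq m] [Fintype n] [DecidableEq n]
    (x : ℝ) (ρ : Matrix (m × n) (m × n) ℂ) : ℝ :=
  ⨅ P : ProjectorPair m, P.deltaW x ρ

/-- The rank-one projector `|v⟩⟨v|`. -/
def ketBra {m : Type*} (v : EuclideanSpace ℂ m) : Matrix m m ℂ :=
  Matrix.vecMulVec (fun i => v i) (fun j => star (v j))

/-- The von Neumann measurement `Π^a(X) = ∑ₖ (|k⟩⟨k| ⊗ 1) X (|k⟩⟨k| ⊗ 1)` of the subsystem `a`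
in the orthonormal basis `e`. -/
def vonNeumannMapAB {m n : Type*} [Fintype m] [DecidableEq m] [Fintype n] [DecidableEq n]
    (e : OrthonormalBasis m ℂ (EuclideanSpace ℂ m)) (X : Matrix (m × n) (m × n) ℂ) :
    Matrix (m × n) (m × n) ℂ :=
  ∑ k, (ketBra (e k) ⊗ₖ (1 : Matrix n n ℂ)) * X * (ketBra (e k) ⊗ₖ (1 : Matrix n n ℂ))

/-- A state is classically correlated if it is invariant under some von Neumann measurement of
the subsystem `a`. -/
def IsClassicallyCorrelated {m n : Type*} [Fintype m] [DecidableEq m] [Fintype n] [DecidableEq n]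
    (ρ : Matrix (m × n) (m × n) ℂ) : Prop :=
  ∃ e : OrthonormalBasis m ℂ (EuclideanSpace ℂ m), vonNeumannMapAB e ρ = ρ

end

/-
Write `p` for the first projector. Since `2p - 1` is unitary and `X - Ω(X)` is a multiple of
`[X, p] (2p - 1)`, the coherence is a nonnegative constant times the Wigner-Yanase skew information
of `p`. So the theorem rests on the fact that the skew information does not increase under the
partial trace. Let `G_kl` be the blocks of `√ρ` over a basis of `b`; then
`∑ G_kl G_lk = ρᵃ = (√ρᵃ)²`, and monotonicity reduces to
`∑ (G_kl)ᵀ ⊗ G_lk ≤ (√ρᵃ)ᵀ ⊗ √ρᵃ`, evaluated at the vectorization of `p`. This is a Cauchy-Schwarz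
inequality in the Loewner order. With `s = (√ρᵃ)ᵀ ⊗ 1`, `t = 1 ⊗ √ρᵃ` (made invertible by adding a
small multiple of `1`) and `x` the left hand side, the C⋆-valued Cauchy-Schwarz inequality gives
`‖s⁻¹ x t⁻¹‖ ≤ 1`. For `c = √(st)` the selfadjoint operator `c⁻¹ x c⁻¹` has the same spectral radius
as `s⁻¹ x t⁻¹`, hence it is at most `1`, which means `x ≤ c² = st`.

The minimum is attained because a projector `p ≠ 0, 1` satisfies `‖p‖ = ‖1 - p‖ = 1`, so these
projectors form a compact set. A state invariant under a projective measurement commutes with each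
of its projectors, and then both skew informations vanish.
-/

section CStarAlgebra

theorem spectralRadius_mul_comm {𝕜 A : Type*} [NormedField 𝕜] [Ring A] [Algebra 𝕜 A] (a b : A) :
    spectralRadius 𝕜 (a * b) = spectralRadius 𝕜 (b * a) := by
  have eq_iSup_nonzero (x : A) :
      spectralRadius 𝕜 x = ⨆ k ∈ spectrum 𝕜 x \ {0}, (‖k‖₊ : ENNReal) := by
    refine le_antisymm (iSup₂_le fun k hk => ?_) (biSup_mono fun _ => And.left)
    by_cases hk0 : k = 0
    · simp [hk0]
    · exact le_biSup (fun k : 𝕜 => (‖k‖₊ : ENNReal)) ⟨hk, hk0⟩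
  rw [eq_iSup_nonzero, eq_iSup_nonzero, spectrum.nonzero_mul_comm]

theorem norm_sum_mul_sq_le {A ι : Type*} [NonUnitalCStarAlgebra A] [PartialOrder A]
    [StarOrderedRing A] [Fintype ι] (r c : ι → A) :
    ‖∑ i, r i * c i‖ ^ 2 ≤ ‖∑ i, r i * star (r i)‖ * ‖∑ i, star (c i) * c i‖ := by
  let x := (WithCStarModule.equiv A (ι → A)).symm fun i => star (c i)
  let y := (WithCStarModule.equiv A (ι → A)).symm r
  have cauchy_schwarz := pow_le_pow_left₀ (norm_nonneg _)
    (CStarModule.norm_inner_le (A := A) _ (x := x) (y := y)) 2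
  rw [mul_pow, WithCStarModule.pi_norm_sq, WithCStarModule.pi_norm_sq, WithCStarModule.pi_inner,
    mul_comm] at cauchy_schwarz
  simpa [x, y, WithCStarModule.inner_def] using cauchy_schwarz

variable {A : Type*} [CStarAlgebra A] [PartialOrder A] [StarOrderedRing A]

theorem le_mul_of_norm_inv_mul_mul_inv_le_one {a b : Aˣ} (hab : 0 ≤ (a * b : A)) {x : A}
    (hx : IsSelfAdjoint x) (h : ‖(↑a⁻¹ * x * ↑b⁻¹ : A)‖ ≤ 1) : x ≤ a * b := by
  nontriviality A
  obtain ⟨c, hc⟩ := (CFC.isUnit_sqrt_iff (a * b : A)).mpr (a * b).isUnit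
  have hc_nonneg : 0 ≤ (c : A) := hc ▸ CFC.sqrt_nonneg _
  have hcc : c * c = a * b := Units.ext <| by simp [hc, CFC.sqrt_mul_sqrt_self _ hab]
  have hcc_inv : (↑c⁻¹ * ↑c⁻¹ : A) = ↑b⁻¹ * ↑a⁻¹ := by
    rw [← Units.val_mul, ← mul_inv_rev, hcc, mul_inv_rev, Units.val_mul]
  set y : A := ↑c⁻¹ * x * ↑c⁻¹ with hy
  have hy_selfAdjoint : IsSelfAdjoint y :=
    hx.conjugate_self (CFC.inv_nonneg_of_nonneg c).isSelfAdjoint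
  have hy_norm : ‖y‖ ≤ 1 := by
    have : spectralRadius ℂ y = spectralRadius ℂ (↑a⁻¹ * x * ↑b⁻¹ : A) := by
      rw [hy, mul_assoc, spectralRadius_mul_comm, mul_assoc, hcc_inv, ← mul_assoc,
        spectralRadius_mul_comm, mul_assoc]
    rw [hy_selfAdjoint.spectralRadius_eq_nnnorm] at this
    exact (NNReal.coe_le_coe.mpr (ENNReal.coe_le_coe.mp
      (this.trans_le (spectrum.spectralRadius_le_nnnorm _)))).trans h
  have hy_le : y ≤ 1 := by
    simpa using hy_selfAdjoint.le_algebraMap_norm_self.trans (algebraMap_mono A hy_norm)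
  calc x = c * y * c := by simp [hy, mul_assoc]
    _ ≤ c * 1 * c := hc_nonneg.isSelfAdjoint.conjugate_le_conjugate hy_le
    _ = a * b := by simpa using congrArg Units.val hcc

theorem norm_inv_mul_mul_star_inv_le_one {a : Aˣ} {s : A} (hs : 0 ≤ s)
    (h : s ≤ a * star (a : A)) : ‖(↑a⁻¹ * s * star ↑a⁻¹ : A)‖ ≤ 1 := by
  rw [CStarAlgebra.norm_le_one_iff_of_nonneg _ (star_right_conjugate_nonneg hs _)]
  calc (↑a⁻¹ * s * star ↑a⁻¹ : A) ≤ ↑a⁻¹ * (a * star (a : A)) * star ↑a⁻¹ :=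
        star_right_conjugate_le_conjugate h _
    _ = 1 := by simp [← mul_assoc, ← star_mul]

variable {ι : Type*} [Fintype ι] {r c : ι → A}

theorem norm_inv_mul_sum_mul_inv_le_one {a b : Aˣ}
    (hr : ∑ i, r i * star (r i) ≤ a * star (a : A))
    (hc : ∑ i, star (c i) * c i ≤ star (b : A) * b) :
    ‖(↑a⁻¹ * (∑ i, r i * c i) * ↑b⁻¹ : A)‖ ≤ 1 := by
  have hr_norm := norm_inv_mul_mul_star_inv_le_one
    (Finset.sum_nonneg fun i _ => mul_star_self_nonneg (r i)) hr
  have hc_norm := norm_inv_mul_mul_star_inv_le_one (a := star b)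
    (Finset.sum_nonneg fun i _ => star_mul_self_nonneg (c i)) (by simpa using hc)
  have cauchy_schwarz := norm_sum_mul_sq_le (fun i => ↑a⁻¹ * r i) (fun i => c i * ↑b⁻¹)
  rw [← sq_le_one_iff₀ (norm_nonneg _)]
  refine le_trans ?_ (mul_le_one₀ hr_norm (norm_nonneg _) hc_norm)
  simpa [Finset.mul_sum, Finset.sum_mul, mul_assoc] using cauchy_schwarz

theorem sum_mul_le_mul_of_isStrictlyPositive {a b : A} (ha : IsStrictlyPositive a)
    (hb : IsStrictlyPositive b) (hab : Commute a b) (hr : ∑ i, r i * star (r i) ≤ a * a)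
    (hc : ∑ i, star (c i) * c i ≤ b * b) (hrc : IsSelfAdjoint (∑ i, r i * c i)) :
    ∑ i, r i * c i ≤ a * b := by
  lift a to Aˣ using ha.isUnit
  lift b to Aˣ using hb.isUnit
  refine le_mul_of_norm_inv_mul_mul_inv_le_one (hab.mul_nonneg ha.nonneg hb.nonneg) hrc
    (norm_inv_mul_sum_mul_inv_le_one ?_ ?_)
  · rwa [ha.isSelfAdjoint.star_eq]
  · rwa [hb.isSelfAdjoint.star_eq]

theorem mul_self_le_add_smul_one_mul_self {a : A} (ha : 0 ≤ a) {ε : ℝ} (hε : 0 ≤ ε) :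
    a * a ≤ (a + ε • 1) * (a + ε • 1) := by
  have h : (a + ε • 1) * (a + ε • 1) = a * a + ((2 * ε) • a + (ε * ε) • 1) := by
    simp only [add_mul, mul_add, smul_mul_assoc, mul_smul_comm, one_mul, mul_one]
    module
  rw [h]
  exact le_add_of_nonneg_right (add_nonneg (smul_nonneg (by positivity) ha)
    (smul_nonneg (by positivity) zero_le_one))

theorem sum_mul_le_mul {a b : A} (ha : 0 ≤ a) (hb : 0 ≤ b) (hab : Commute a b)
    (hr : ∑ i, r i * star (r i) ≤ a * a) (hc : ∑ i, star (c i) * c i ≤ b * b)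
    (hrc : IsSelfAdjoint (∑ i, r i * c i)) : ∑ i, r i * c i ≤ a * b := by
  have tendsto : Filter.Tendsto (fun ε : ℝ => (a + ε • 1) * (b + ε • 1))
      (nhdsWithin 0 (Set.Ioi 0)) (nhds (a * b)) := by
    have : Continuous fun ε : ℝ => (a + ε • 1) * (b + ε • 1) := by fun_prop
    simpa using (this.tendsto 0).mono_left nhdsWithin_le_nhds
  refine ge_of_tendsto tendsto ?_
  filter_upwards [self_mem_nhdsWithin] with ε (hε : 0 < ε)
  have isStrictlyPositive_add {d : A} (hd : 0 ≤ d) : IsStrictlyPositive (d + ε • 1) :=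
    .nonneg_add hd (.smul hε isStrictlyPositive_one)
  have commute : Commute (a + ε • 1) (b + ε • 1) :=
    .add_left (hab.add_right ((Commute.one_right a).smul_right ε))
      ((Commute.one_left _).smul_left ε)
  exact sum_mul_le_mul_of_isStrictlyPositive (isStrictlyPositive_add ha)
    (isStrictlyPositive_add hb) commute
    (hr.trans (mul_self_le_add_smul_one_mul_self ha hε.le))
    (hc.trans (mul_self_le_add_smul_one_mul_self hb hε.le)) hrc

end CStarAlgebra

section Kronecker

variable {m n : Type*} [Fintype m] [DecidableEq m] [Fintype n] [DecidableEq n]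

variable (n) in
/-- The ampliation `A ↦ A ⊗ 1` of operators on the first factor to operators on `m × n`. -/
@[simps]
def kroneckerOne : Matrix m m ℂ →⋆ₐ[ℂ] Matrix (m × n) (m × n) ℂ where
  toFun A := A ⊗ₖ 1
  map_one' := Matrix.one_kronecker_one
  map_mul' A B := by simp [← Matrix.mul_kronecker_mul]
  map_zero' := Matrix.zero_kronecker _
  map_add' A B := Matrix.add_kronecker A B _
  commutes' z := by simp [Algebra.algebraMap_eq_smul_one, Matrix.smul_kronecker]
  map_star' A := by simp [Matrix.star_eq_conjTranspose, Matrix.conjTranspose_kronecker]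

variable (m) in
/-- The ampliation `B ↦ 1 ⊗ B` of operators on the second factor to operators on `m × n`. -/
@[simps]
def oneKronecker : Matrix n n ℂ →⋆ₐ[ℂ] Matrix (m × n) (m × n) ℂ where
  toFun B := 1 ⊗ₖ B
  map_one' := Matrix.one_kronecker_one
  map_mul' A B := by simp [← Matrix.mul_kronecker_mul]
  map_zero' := Matrix.kronecker_zero _
  map_add' A B := Matrix.kronecker_add _ A B
  commutes' z := by simp [Algebra.algebraMap_eq_smul_one, Matrix.kronecker_smul]
  map_star' A := by simp [Matrix.star_eq_conjTranspose, Matrix.conjTranspose_kronecker]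

theorem kroneckerOne_mul_oneKronecker (A : Matrix m m ℂ) (B : Matrix n n ℂ) :
    kroneckerOne n A * oneKronecker m B = A ⊗ₖ B := by
  simp [← Matrix.mul_kronecker_mul]

theorem commute_kroneckerOne_oneKronecker (A : Matrix m m ℂ) (B : Matrix n n ℂ) :
    Commute (kroneckerOne n A) (oneKronecker m B) := by
  simp [Commute, SemiconjBy, ← Matrix.mul_kronecker_mul]

end Kronecker

section PartialTrace

variable {m n : Type*}

/-- The block `⟨k| G |l⟩` of an operator `G` on `ab` between two basis vectors of `b`: an operator
on `a`. -/
def blockB (G : Matrix (m × n) (m × n) ℂ) (k l : n) : Matrix m m ℂ :=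
  G.submatrix (·, k) (·, l)

theorem blockB_kronecker_one [DecidableEq n] (A : Matrix m m ℂ) (k l : n) :
    blockB (A ⊗ₖ 1) k l = if k = l then A else 0 := by
  split_ifs <;> ext <;> simp_all [blockB]

variable [Fintype n]

theorem marginalA_eq_sum_blockB (G : Matrix (m × n) (m × n) ℂ) :
    marginalA G = ∑ k, blockB G k k := by
  ext i j
  simp [marginalA, blockB, Matrix.sum_apply]

theorem posSemidef_marginalA {ρ : Matrix (m × n) (m × n) ℂ} (hρ : ρ.PosSemidef) :
    (marginalA ρ).PosSemidef := by
  rw [marginalA_eq_sum_blockB]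
  exact Matrix.posSemidef_sum _ fun k _ => hρ.submatrix (·, k)

variable [Fintype m]

theorem blockB_mul (G H : Matrix (m × n) (m × n) ℂ) (k l : n) :
    blockB (G * H) k l = ∑ j, blockB G k j * blockB H j l := by
  ext a b
  simp only [blockB, Matrix.submatrix_apply, Matrix.mul_apply, Matrix.sum_apply,
    Fintype.sum_prod_type_right]

theorem trace_marginalA (G : Matrix (m × n) (m × n) ℂ) : (marginalA G).trace = G.trace := by
  simp [Matrix.trace, marginalA, Fintype.sum_prod_type]

theorem marginalA_mul (G H : Matrix (m × n) (m × n) ℂ) :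
    marginalA (G * H) = ∑ p : n × n, blockB G p.1 p.2 * blockB H p.2 p.1 := by
  simp only [marginalA_eq_sum_blockB, blockB_mul, Fintype.sum_prod_type]

variable [DecidableEq n]

theorem blockB_mul_kronecker_one (G : Matrix (m × n) (m × n) ℂ) (A : Matrix m m ℂ) (k l : n) :
    blockB (G * A ⊗ₖ 1) k l = blockB G k l * A := by
  simp [blockB_mul, blockB_kronecker_one]

theorem marginalA_mul_kronecker_one (G : Matrix (m × n) (m × n) ℂ) (A : Matrix m m ℂ) :
    marginalA (G * A ⊗ₖ 1) = marginalA G * A := by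
  simp [marginalA_eq_sum_blockB, blockB_mul_kronecker_one, Finset.sum_mul]

theorem marginalA_kronecker_one_mul (G : Matrix (m × n) (m × n) ℂ) (A : Matrix m m ℂ) :
    marginalA (A ⊗ₖ 1 * G) = A * marginalA G := by
  simp [marginalA_eq_sum_blockB, blockB_mul, blockB_kronecker_one, Finset.mul_sum]

end PartialTrace

section TraceInequality

variable {m n : Type*} [Fintype m] [Fintype n]

open scoped Matrix.Norms.L2Operator in
theorem sum_kronecker_le_kronecker {ι : Type*} [Fintype ι] {S : Matrix m m ℂ}
    {T : Matrix n n ℂ} (hS : 0 ≤ S) (hT : 0 ≤ T) {A : ι → Matrix m m ℂ} {B : ι → Matrix n n ℂ}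
    (hA : ∑ i, A i * star (A i) ≤ S * S) (hB : ∑ i, star (B i) * B i ≤ T * T)
    (hAB : IsSelfAdjoint (∑ i, A i ⊗ₖ B i)) : ∑ i, A i ⊗ₖ B i ≤ S ⊗ₖ T := by
  classical
  simp only [← kroneckerOne_mul_oneKronecker] at hAB ⊢
  refine sum_mul_le_mul (map_nonneg (kroneckerOne n) hS) (map_nonneg (oneKronecker m) hT)
    (commute_kroneckerOne_oneKronecker S T) ?_ ?_ hAB
  · simpa only [map_sum, map_mul, map_star] using OrderHomClass.mono (kroneckerOne n) hA
  · simpa only [map_sum, map_mul, map_star] using OrderHomClass.mono (oneKronecker m) hB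

theorem star_dotProduct_mulVec_mono {A B : Matrix m m ℂ} (h : A ≤ B) (v : m → ℂ) :
    star v ⬝ᵥ A *ᵥ v ≤ star v ⬝ᵥ B *ᵥ v := by
  rw [← sub_nonneg, ← dotProduct_sub, ← Matrix.sub_mulVec]
  exact (Matrix.le_iff.mp h).dotProduct_mulVec_nonneg v

theorem star_vec_dotProduct_transpose_kronecker_mulVec_vec (A B K : Matrix m m ℂ) :
    star K.vec ⬝ᵥ (Aᵀ ⊗ₖ B) *ᵥ K.vec = (A * Kᴴ * B * K).trace := by
  rw [Matrix.kronecker_mulVec_vec, Matrix.star_vec_dotProduct_vec, Matrix.transpose_transpose,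
    ← Matrix.mul_assoc, Matrix.trace_mul_comm]
  simp only [Matrix.mul_assoc]

variable {G : Matrix (m × n) (m × n) ℂ}

theorem sum_transpose_blockB_kronecker_blockB_le (hG : G.IsHermitian) {S : Matrix m m ℂ}
    (hS : S.PosSemidef) (hSG : S * S = marginalA (G * G)) :
    ∑ p : n × n, (blockB G p.1 p.2)ᵀ ⊗ₖ blockB G p.2 p.1 ≤ Sᵀ ⊗ₖ S := by
  have star_block (k l : n) : star (blockB G k l) = blockB G l k := by
    rw [Matrix.star_eq_conjTranspose, blockB, Matrix.conjTranspose_submatrix, hG.eq, blockB]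
  have star_block_transpose (k l : n) : star (blockB G k l)ᵀ = (blockB G l k)ᵀ := by
    rw [← star_block k l]
    rfl
  have sum_swap {R : Type _} [AddCommMonoid R] (f : n × n → R) :
      ∑ p : n × n, f p.swap = ∑ p, f p := (Equiv.prodComm n n).sum_comp f
  refine sum_kronecker_le_kronecker hS.transpose.nonneg hS.nonneg ?_ ?_ ?_
  · rw [← Matrix.transpose_mul, hSG, marginalA_mul, ← sum_swap]
    simp [star_block_transpose, ← Matrix.transpose_mul, Matrix.transpose_sum]
  · simp [star_block, hSG, marginalA_mul]
  · rw [IsSelfAdjoint, star_sum, ← sum_swap]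
    simp only [Matrix.star_eq_conjTranspose] at star_block star_block_transpose ⊢
    simp [Matrix.conjTranspose_kronecker, star_block, star_block_transpose]

theorem trace_sandwich_kronecker_one_le [DecidableEq n] (hG : G.IsHermitian) {S : Matrix m m ℂ}
    (hS : S.PosSemidef) (hSG : S * S = marginalA (G * G)) (K : Matrix m m ℂ) :
    (G * (Kᴴ ⊗ₖ 1) * G * (K ⊗ₖ 1)).trace ≤ (S * Kᴴ * S * K).trace := by
  calc (G * (Kᴴ ⊗ₖ 1) * G * (K ⊗ₖ 1)).trace
      = ∑ p : n × n, (blockB G p.1 p.2 * Kᴴ * blockB G p.2 p.1 * K).trace := by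
        rw [Matrix.mul_assoc (G * _), ← trace_marginalA, marginalA_mul, Matrix.trace_sum]
        simp only [blockB_mul_kronecker_one, Matrix.mul_assoc]
    _ = star K.vec ⬝ᵥ (∑ p : n × n, (blockB G p.1 p.2)ᵀ ⊗ₖ blockB G p.2 p.1) *ᵥ K.vec := by
        simp only [← star_vec_dotProduct_transpose_kronecker_mulVec_vec, Matrix.sum_mulVec,
          dotProduct_sum]
    _ ≤ star K.vec ⬝ᵥ (Sᵀ ⊗ₖ S) *ᵥ K.vec :=
        star_dotProduct_mulVec_mono (sum_transpose_blockB_kronecker_blockB_le hG hS hSG) _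
    _ = (S * Kᴴ * S * K).trace := star_vec_dotProduct_transpose_kronecker_mulVec_vec S S K

end TraceInequality

section HilbertSchmidt

variable {ι : Type*} [Fintype ι]

theorem hsNorm_sq (O : Matrix ι ι ℂ) : hsNorm O ^ 2 = (Oᴴ * O).trace.re :=
  Real.sq_sqrt (Complex.nonneg_iff.mp
    (Matrix.posSemidef_conjTranspose_mul_self O).trace_nonneg).1

theorem hsNorm_smul_sq (c : ℂ) (O : Matrix ι ι ℂ) :
    hsNorm (c • O) ^ 2 = ‖c‖ ^ 2 * hsNorm O ^ 2 := by
  rw [hsNorm_sq, hsNorm_sq, Matrix.conjTranspose_smul, Matrix.smul_mul, Matrix.mul_smul, smul_smul,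
    Matrix.trace_smul, Complex.star_def, Complex.conj_mul', smul_eq_mul, ← Complex.ofReal_pow,
    Complex.re_ofReal_mul]

theorem hsNorm_mul_unitary [DecidableEq ι] (O : Matrix ι ι ℂ) {U : Matrix ι ι ℂ}
    (hU : U ∈ unitary (Matrix ι ι ℂ)) : hsNorm (O * U) = hsNorm O := by
  rw [hsNorm, hsNorm, Matrix.conjTranspose_mul, Matrix.mul_assoc, Matrix.trace_mul_comm,
    Matrix.mul_assoc, Matrix.mul_assoc, ← Matrix.star_eq_conjTranspose U,
    Unitary.mul_star_self_of_mem hU, Matrix.mul_one]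

theorem continuous_hsNorm : Continuous (hsNorm : Matrix ι ι ℂ → ℝ) := by
  unfold hsNorm
  fun_prop

theorem hsNorm_lie_sq {X K : Matrix ι ι ℂ} (hX : X.IsHermitian) (hK : K.IsHermitian) :
    hsNorm ⁅X, K⁆ ^ 2 = 2 * ((X * X * (K * K)).trace.re - (X * K * X * K).trace.re) := by
  have conj_mul_self : ⁅X, K⁆ᴴ * ⁅X, K⁆ =
      K * (X * X * K) - K * (X * K * X) - X * K * X * K + X * (K * K) * X := by
    rw [Ring.lie_def, Matrix.conjTranspose_sub, Matrix.conjTranspose_mul,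
      Matrix.conjTranspose_mul, hX.eq, hK.eq]
    noncomm_ring
  rw [hsNorm_sq, conj_mul_self]
  rw [Matrix.trace_add, Matrix.trace_sub, Matrix.trace_sub, Matrix.trace_mul_comm K,
    Matrix.trace_mul_comm K, Matrix.trace_mul_comm (X * (K * K)) X]
  simp only [Matrix.mul_assoc, Complex.add_re, Complex.sub_re]
  ring

theorem sub_weak_eq_smul_lie_mul {R A : Type*} [CommRing R] [Ring A] [Algebra R A] {p q : A}
    (hp : IsIdempotentElem p) (hpq : p + q = 1) (X : A) {s t : R} (hst : s ^ 2 + t ^ 2 = 1) :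
    X - ((s • p + t • q) * X * (s • p + t • q) + (t • p + s • q) * X * (t • p + s • q)) =
      (1 - 2 * s * t) • (⁅X, p⁆ * (2 * p - 1)) := by
  obtain rfl : q = 1 - p := eq_sub_of_add_eq' hpq
  have hlie : ⁅X, p⁆ * (2 * p - 1) = X * p + p * X - (2 : R) • (p * (X * p)) := by
    simp only [Ring.lie_def, sub_mul, mul_sub, two_mul, mul_add, mul_one, mul_assoc, hp.eq]
    module
  have hfactor : 1 - 2 * s * t = (s - t) ^ 2 := by linear_combination -hst
  rw [hlie, hfactor]
  simp only [mul_sub, sub_mul, mul_add, add_mul, smul_mul_assoc, mul_smul_comm, mul_one, one_mul,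
    mul_assoc]
  linear_combination (norm := module) -hst • X

theorem hsNorm_sub_weak_sq [DecidableEq ι] {p q : Matrix ι ι ℂ} (hp : IsStarProjection p)
    (hpq : p + q = 1) (X : Matrix ι ι ℂ) {s t : ℝ} (hst : s ^ 2 + t ^ 2 = 1) :
    hsNorm (X - (((s : ℂ) • p + (t : ℂ) • q) * X * ((s : ℂ) • p + (t : ℂ) • q) +
      ((t : ℂ) • p + (s : ℂ) • q) * X * ((t : ℂ) • p + (s : ℂ) • q))) ^ 2 =
      (1 - 2 * s * t) ^ 2 * hsNorm ⁅X, p⁆ ^ 2 := by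
  rw [sub_weak_eq_smul_lie_mul hp.isIdempotentElem hpq X (by exact_mod_cast hst), hsNorm_smul_sq,
    hsNorm_mul_unitary _ hp.two_mul_sub_one_mem_unitary]
  norm_cast
  rw [Real.norm_eq_abs, sq_abs]

end HilbertSchmidt

section SkewInformation

variable {ι m n : Type*} [Fintype ι] [DecidableEq ι] [Fintype m] [DecidableEq m] [Fintype n]
  [DecidableEq n]

/-- The Wigner-Yanase skew information `-½ tr [√ρ, K]²`, written as `½ ‖[√ρ, K]‖²`; the two agree
for hermitian `K`. -/
noncomputable def skewInformation (ρ K : Matrix ι ι ℂ) : ℝ :=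
  hsNorm ⁅CFC.sqrt ρ, K⁆ ^ 2 / 2

theorem skewInformation_eq {ρ K : Matrix ι ι ℂ} (hρ : ρ.PosSemidef) (hK : K.IsHermitian) :
    skewInformation ρ K =
      (ρ * (K * K)).trace.re - (CFC.sqrt ρ * K * CFC.sqrt ρ * K).trace.re := by
  rw [skewInformation, hsNorm_lie_sq (CFC.sqrt_nonneg ρ).isSelfAdjoint hK,
    CFC.sqrt_mul_sqrt_self ρ hρ.nonneg]
  ring

theorem skewInformation_eq_zero_of_commute {ρ K : Matrix ι ι ℂ} (h : Commute ρ K) :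
    skewInformation ρ K = 0 := by
  have hsqrt : Commute (CFC.sqrt ρ) K := by
    rw [CFC.sqrt_eq_cfc]
    exact h.cfc_nnreal _
  simp [skewInformation, commute_iff_lie_eq.mp hsqrt, hsNorm]

theorem continuous_skewInformation (ρ : Matrix ι ι ℂ) : Continuous (skewInformation ρ) := by
  have : Continuous fun K : Matrix ι ι ℂ => ⁅CFC.sqrt ρ, K⁆ := by
    simp only [Ring.lie_def]
    fun_prop
  exact ((continuous_hsNorm.comp this).pow 2).div_const 2

theorem skewInformation_marginalA_le {ρ : Matrix (m × n) (m × n) ℂ} (hρ : ρ.PosSemidef)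
    {K : Matrix m m ℂ} (hK : K.IsHermitian) :
    skewInformation (marginalA ρ) K ≤ skewInformation ρ (K ⊗ₖ 1) := by
  have hρa := posSemidef_marginalA hρ
  have hK1 : (K ⊗ₖ (1 : Matrix n n ℂ)).IsHermitian := by
    rw [Matrix.IsHermitian, Matrix.conjTranspose_kronecker, hK.eq, Matrix.conjTranspose_one]
  have trace_sq : (ρ * (K ⊗ₖ 1 * K ⊗ₖ 1)).trace = (marginalA ρ * (K * K)).trace := by
    rw [← Matrix.mul_kronecker_mul, Matrix.mul_one, ← trace_marginalA,
      marginalA_mul_kronecker_one]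
  have trace_sandwich := trace_sandwich_kronecker_one_le
    (CFC.sqrt_nonneg ρ).isSelfAdjoint (Matrix.nonneg_iff_posSemidef.mp (CFC.sqrt_nonneg _))
    (by rw [CFC.sqrt_mul_sqrt_self _ hρa.nonneg, CFC.sqrt_mul_sqrt_self ρ hρ.nonneg]) K
  rw [hK.eq] at trace_sandwich
  rw [skewInformation_eq hρa hK, skewInformation_eq hρ hK1, trace_sq]
  exact sub_le_sub_left (Complex.le_def.mp trace_sandwich).1 _

end SkewInformation

section WeakMeasurement

theorem tauOne_sq_add_tauTwo_sq (x : ℝ) : tauOne x ^ 2 + tauTwo x ^ 2 = 1 := by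
  have := Real.neg_one_lt_tanh x
  have := Real.tanh_lt_one x
  rw [tauOne, tauTwo, Real.sq_sqrt (by linarith), Real.sq_sqrt (by linarith)]
  ring

/-- The constant by which the coherence of a weak measurement of strength `x` exceeds the skew
information of either projector. -/
noncomputable def weakFactor (x : ℝ) : ℝ :=
  2 * (1 - 2 * tauOne x * tauTwo x) ^ 2

theorem weakFactor_nonneg (x : ℝ) : 0 ≤ weakFactor x := by
  unfold weakFactor
  positivity

namespace ProjectorPair

variable {m n : Type*} [Fintype m] [DecidableEq m] [Fintype n] [DecidableEq n]

theorem coherence_eq (P : ProjectorPair m) (x : ℝ) (σ : Matrix m m ℂ) :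
    P.coherence x σ = weakFactor x * skewInformation σ P.P₁ := by
  rw [coherence, weakMap, weakPos, weakNeg, hsNorm_sub_weak_sq P.isStarProjection₁ P.sum_eq_one _
    (tauOne_sq_add_tauTwo_sq x), weakFactor, skewInformation]
  ring

theorem coherenceAB_eq (P : ProjectorPair m) (x : ℝ) (ρ : Matrix (m × n) (m × n) ℂ) :
    P.coherenceAB x ρ = weakFactor x * skewInformation ρ (P.P₁ ⊗ₖ 1) := by
  have isStarProjection : IsStarProjection (P.P₁ ⊗ₖ (1 : Matrix n n ℂ)) :=
    P.isStarProjection₁.map (kroneckerOne n)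
  have sum_eq_one : P.P₁ ⊗ₖ (1 : Matrix n n ℂ) + P.P₂ ⊗ₖ 1 = 1 := by
    rw [← Matrix.add_kronecker, P.sum_eq_one, Matrix.one_kronecker_one]
  simp only [coherenceAB, weakMapAB, weakPos, weakNeg, Matrix.add_kronecker,
    Matrix.smul_kronecker]
  rw [hsNorm_sub_weak_sq isStarProjection sum_eq_one _ (tauOne_sq_add_tauTwo_sq x), weakFactor,
    skewInformation]
  ring

theorem deltaW_eq (P : ProjectorPair m) (x : ℝ) (ρ : Matrix (m × n) (m × n) ℂ) :
    P.deltaW x ρ = weakFactor x *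
      (skewInformation ρ (P.P₁ ⊗ₖ 1) - skewInformation (marginalA ρ) P.P₁) := by
  rw [deltaW, coherenceAB_eq, coherence_eq, mul_sub]

theorem deltaW_nonneg (P : ProjectorPair m) (x : ℝ) {ρ : Matrix (m × n) (m × n) ℂ}
    (hρ : ρ.PosSemidef) : 0 ≤ P.deltaW x ρ := by
  rw [deltaW_eq]
  exact mul_nonneg (weakFactor_nonneg x) <| sub_nonneg.mpr <|
    skewInformation_marginalA_le hρ P.isStarProjection₁.isSelfAdjoint

theorem deltaW_eq_zero_of_commute (P : ProjectorPair m) (x : ℝ) {ρ : Matrix (m × n) (m × n) ℂ}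
    (h : Commute ρ (P.P₁ ⊗ₖ 1)) : P.deltaW x ρ = 0 := by
  have marginal_commute : Commute (marginalA ρ) P.P₁ := by
    rw [Commute, SemiconjBy, ← marginalA_mul_kronecker_one, h.eq, marginalA_kronecker_one_mul]
  rw [deltaW_eq, skewInformation_eq_zero_of_commute h,
    skewInformation_eq_zero_of_commute marginal_commute, sub_zero, mul_zero]

end ProjectorPair

end WeakMeasurement

section Compactness

theorem norm_eq_one_iff_of_isStarProjection {A : Type*} [NonUnitalNormedRing A] [StarRing A]
    [CStarRing A] {p : A} (hp : IsStarProjection p) : ‖p‖ = 1 ↔ p ≠ 0 := by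
  refine ⟨fun h => norm_pos_iff.mp (h ▸ one_pos), fun h => ?_⟩
  have norm_mul_norm := CStarRing.norm_star_mul_self (x := p)
  rw [hp.isSelfAdjoint.star_eq, hp.isIdempotentElem.eq] at norm_mul_norm
  exact (mul_eq_left₀ (norm_ne_zero_iff.mpr h)).mp norm_mul_norm.symm

theorem isCompact_setOf_isStarProjection {A : Type*} [NormedRing A] [StarRing A] [CStarRing A]
    [ProperSpace A] : IsCompact {p : A | IsStarProjection p ∧ p ≠ 0 ∧ p ≠ 1} := by
  have setOf_eq : {p : A | IsStarProjection p ∧ p ≠ 0 ∧ p ≠ 1} =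
      {p | (p * p = p ∧ star p = p) ∧ ‖p‖ = 1 ∧ ‖1 - p‖ = 1} := by
    ext p
    simp only [Set.mem_ofPred_eq, ← isStarProjection_iff']
    refine and_congr_right fun hp => ?_
    rw [norm_eq_one_iff_of_isStarProjection hp, norm_eq_one_iff_of_isStarProjection hp.one_sub,
      sub_ne_zero, ne_comm (a := 1)]
  rw [setOf_eq]
  refine (isCompact_closedBall (0 : A) 1).of_isClosed_subset ?_ fun p hp =>
    mem_closedBall_zero_iff.mpr hp.2.1.le
  exact ((isClosed_eq (by fun_prop) (by fun_prop)).inter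
    (isClosed_eq (by fun_prop) (by fun_prop))).inter
    ((isClosed_eq (by fun_prop) (by fun_prop)).inter (isClosed_eq (by fun_prop) (by fun_prop)))

namespace ProjectorPair

variable {m n : Type*} [Fintype m] [DecidableEq m] [Fintype n] [DecidableEq n]

/-- The pair formed by a proper nonzero projector and its complement. -/
def ofIsStarProjection (p : Matrix m m ℂ) (hp : IsStarProjection p) (h0 : p ≠ 0) (h1 : p ≠ 1) :
    ProjectorPair m where
  P₁ := p
  P₂ := 1 - p
  isStarProjection₁ := hp
  isStarProjection₂ := hp.one_sub
  orthogonal := hp.mul_one_sub_self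
  sum_eq_one := add_sub_cancel p 1
  ne_zero₁ := h0
  ne_zero₂ := sub_ne_zero.mpr h1.symm

theorem range_P₁ : Set.range (P₁ : ProjectorPair m → Matrix m m ℂ) =
    {p | IsStarProjection p ∧ p ≠ 0 ∧ p ≠ 1} := by
  ext p
  refine ⟨?_, fun ⟨hp, h0, h1⟩ => ⟨ofIsStarProjection p hp h0 h1, rfl⟩⟩
  rintro ⟨P, rfl⟩
  exact ⟨P.isStarProjection₁, P.ne_zero₁, fun h => P.ne_zero₂ <| by simpa [h] using P.sum_eq_one⟩

open scoped Matrix.Norms.L2Operator in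
theorem isCompact_range_P₁ : IsCompact (Set.range (P₁ : ProjectorPair m → Matrix m m ℂ)) := by
  have : ProperSpace (Matrix m m ℂ) := FiniteDimensional.proper ℂ _
  rw [range_P₁]
  exact isCompact_setOf_isStarProjection

theorem isCompact_range_deltaW (x : ℝ) (ρ : Matrix (m × n) (m × n) ℂ) :
    IsCompact (Set.range fun P : ProjectorPair m => P.deltaW x ρ) := by
  have continuous_kronecker_one : Continuous fun p : Matrix m m ℂ => p ⊗ₖ (1 : Matrix n n ℂ) :=
    (kroneckerOne (m := m) n).toLinearMap.continuous_of_finiteDimensional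
  have continuous_deltaW : Continuous fun p : Matrix m m ℂ => weakFactor x *
      (skewInformation ρ (p ⊗ₖ 1) - skewInformation (marginalA ρ) p) :=
    continuous_const.mul (((continuous_skewInformation ρ).comp continuous_kronecker_one).sub
      (continuous_skewInformation _))
  simpa only [← Set.range_comp, Function.comp_def, deltaW_eq] using
    isCompact_range_P₁.image continuous_deltaW

end ProjectorPair

end Compactness

section ClassicalCorrelation

theorem commute_of_sum_mul_mul_eq_self {R ι : Type*} [Semiring R] [Fintype ι] {e : ι → R}
    (he : OrthogonalIdempotents e) {x : R} (hx : ∑ i, e i * x * e i = x) (i : ι) :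
    Commute x (e i) := by
  classical
  have mul_right : x * e i = e i * x * e i := by
    conv_lhs => rw [← hx]
    simp [Finset.sum_mul, mul_assoc, he.mul_eq]
  have mul_left : e i * x = e i * x * e i := by
    conv_lhs => rw [← hx]
    simp [Finset.mul_sum, ← mul_assoc, he.mul_eq]
  exact mul_right.trans mul_left.symm

theorem ketBra_ne_zero {ι : Type*} {v : EuclideanSpace ℂ ι} (hv : v ≠ 0) : ketBra v ≠ 0 := by
  intro h
  apply hv
  ext i
  simpa [ketBra, Matrix.vecMulVec_apply] using congrFun (congrFun h i) i

variable {m n : Type*} [Fintype m]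

theorem ketBra_mul_ketBra (v w : EuclideanSpace ℂ m) :
    ketBra v * ketBra w = inner ℂ v w • Matrix.vecMulVec v (star w) := by
  rw [ketBra, ketBra, Matrix.vecMulVec_mul_vecMulVec, Matrix.vecMulVec_smul]
  rw [EuclideanSpace.inner_eq_star_dotProduct, dotProduct_comm]
  rfl

theorem isStarProjection_ketBra {v : EuclideanSpace ℂ m} (hv : ‖v‖ = 1) :
    IsStarProjection (ketBra v) := by
  refine ⟨?_, ?_⟩
  · rw [IsIdempotentElem, ketBra_mul_ketBra, inner_self_eq_norm_sq_to_K, hv]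
    simp only [RCLike.ofReal_one, one_pow, one_smul]
    rfl
  · ext
    simp [ketBra, Matrix.vecMulVec_apply, mul_comm]

variable [DecidableEq m]

theorem orthogonalIdempotents_ketBra {ι : Type*} {v : ι → EuclideanSpace ℂ m}
    (hv : Orthonormal ℂ v) : OrthogonalIdempotents fun k => ketBra (v k) where
  idem k := (isStarProjection_ketBra (hv.norm_eq_one k)).isIdempotentElem
  ortho k l hkl := by
    simp [ketBra_mul_ketBra, hv.inner_eq_zero hkl]

theorem ketBra_ne_one {ι : Type*} [Nontrivial ι] {v : ι → EuclideanSpace ℂ m}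
    (hv : Orthonormal ℂ v) (i : ι) : ketBra (v i) ≠ 1 := by
  obtain ⟨j, hj⟩ := exists_ne i
  intro h
  have ketBra_eq_zero : ketBra (v i) * ketBra (v j) = 0 :=
    (orthogonalIdempotents_ketBra hv).ortho hj.symm
  rw [h, one_mul] at ketBra_eq_zero
  exact ketBra_ne_zero (hv.ne_zero j) ketBra_eq_zero

variable [Fintype n] [DecidableEq n]

theorem commute_kronecker_one_of_sum_eq_self {ι : Type*} [Fintype ι] {e : ι → Matrix m m ℂ}
    (he : OrthogonalIdempotents e) {ρ : Matrix (m × n) (m × n) ℂ}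
    (h : ∑ i, e i ⊗ₖ 1 * ρ * e i ⊗ₖ 1 = ρ) (i : ι) : Commute ρ (e i ⊗ₖ 1) := by
  have ampliation : OrthogonalIdempotents fun i => e i ⊗ₖ (1 : Matrix n n ℂ) :=
    he.map (RingHomClass.toRingHom (kroneckerOne n))
  exact commute_of_sum_mul_mul_eq_self ampliation h i

namespace ProjectorPair

theorem orthogonalIdempotents (P : ProjectorPair m) : OrthogonalIdempotents ![P.P₁, P.P₂] := by
  have orthogonal' : P.P₂ * P.P₁ = 0 := by
    simpa [P.isStarProjection₁.isSelfAdjoint.star_eq, P.isStarProjection₂.isSelfAdjoint.star_eq]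
      using congrArg star P.orthogonal
  exact (CompleteOrthogonalIdempotents.pair_iff'ₛ.mpr
    ⟨P.orthogonal, orthogonal', P.sum_eq_one⟩).toOrthogonalIdempotents

theorem commute_of_projMapAB_eq_self {P : ProjectorPair m} {ρ : Matrix (m × n) (m × n) ℂ}
    (h : P.projMapAB ρ = ρ) : Commute ρ (P.P₁ ⊗ₖ 1) :=
  commute_kronecker_one_of_sum_eq_self P.orthogonalIdempotents
    (by simpa [projMapAB] using h) 0

variable [Nontrivial m]

/-- The measurement of the `i`-th vector of an orthonormal basis against all the others. -/
noncomputable def ofOrthonormalBasis (e : OrthonormalBasis m ℂ (EuclideanSpace ℂ m)) (i : m) :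
    ProjectorPair m :=
  ofIsStarProjection (ketBra (e i)) (isStarProjection_ketBra (e.norm_eq_one i))
    (ketBra_ne_zero (e.orthonormal.ne_zero i)) (ketBra_ne_one e.orthonormal i)

instance : Nonempty (ProjectorPair m) :=
  ⟨ofOrthonormalBasis (EuclideanSpace.basisFun m ℂ) (Classical.arbitrary m)⟩

theorem exists_commute_of_isClassicallyCorrelated {ρ : Matrix (m × n) (m × n) ℂ}
    (h : IsClassicallyCorrelated ρ) : ∃ P : ProjectorPair m, Commute ρ (P.P₁ ⊗ₖ 1) := by
  obtain ⟨e, he⟩ := h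
  obtain ⟨i⟩ : Nonempty m := inferInstance
  exact ⟨ofOrthonormalBasis e i, commute_kronecker_one_of_sum_eq_self
    (orthogonalIdempotents_ketBra e.orthonormal) he i⟩

end ProjectorPair

end ClassicalCorrelation

section WeakCorrelation

variable {m n : Type*} [Fintype m] [DecidableEq m] [Fintype n] [DecidableEq n]

theorem isLeast_weakCorrelation [Nontrivial m] (x : ℝ) (ρ : Matrix (m × n) (m × n) ℂ) :
    IsLeast (Set.range fun P : ProjectorPair m => P.deltaW x ρ) (weakCorrelation x ρ) :=
  (ProjectorPair.isCompact_range_deltaW x ρ).isLeast_sInf (Set.range_nonempty _)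

theorem weakCorrelation_nonneg (x : ℝ) {ρ : Matrix (m × n) (m × n) ℂ} (hρ : ρ.PosSemidef) :
    0 ≤ weakCorrelation x ρ :=
  Real.iInf_nonneg fun P => P.deltaW_nonneg x hρ

theorem weakCorrelation_eq_zero_of_commute (x : ℝ) {ρ : Matrix (m × n) (m × n) ℂ}
    (hρ : ρ.PosSemidef) {P : ProjectorPair m} (h : Commute ρ (P.P₁ ⊗ₖ 1)) :
    weakCorrelation x ρ = 0 :=
  le_antisymm ((ciInf_le (ProjectorPair.isCompact_range_deltaW x ρ).bddBelow P).trans_eq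
    (P.deltaW_eq_zero_of_commute x h)) (weakCorrelation_nonneg x hρ)

end WeakCorrelation

theorem mainTheorem8 {m n : Type*} [Fintype m] [DecidableEq m] [Nontrivial m]
    [Fintype n] [DecidableEq n] (x : ℝ) (ρ : Matrix (m × n) (m × n) ℂ)
    (hρ : IsDensityMatrix ρ) :
    IsLeast (Set.range fun P : ProjectorPair m => P.deltaW x ρ) (weakCorrelation x ρ) ∧
      0 ≤ weakCorrelation x ρ ∧
      (IsClassicallyCorrelated ρ → weakCorrelation x ρ = 0) ∧
      ((∃ P : ProjectorPair m, P.projMapAB ρ = ρ) → weakCorrelation x ρ = 0) := by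
  refine ⟨isLeast_weakCorrelation x ρ, weakCorrelation_nonneg x hρ.1, fun h => ?_, ?_⟩
  · obtain ⟨P, hP⟩ := ProjectorPair.exists_commute_of_isClassicallyCorrelated h
    exact weakCorrelation_eq_zero_of_commute x hρ.1 hP
  · rintro ⟨P, hP⟩
    exact weakCorrelation_eq_zero_of_commute x hρ.1 (P.commute_of_projMapAB_eq_self hP)
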